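/- Let $\Omega$ be a non-empty set, $\mathcal{E}$ an arbitrary family of subsets (events) of $\Omega$, and $P:\mathcal{E}\to[0,1]$ any function (a probability assessment). For a family $\mathcal{G}$ of subsets of a set, $\mathbf{algebra}(\mathcal{G})$ denotes the smallest algebra of subsets of that set containing $\mathcal{G}$. A finitely additive probability on an algebra $\mathcal{A}$ is a map $\mathcal{A}\to[0,1]$ that takes the value $1$ on the whole space and is additive on disjoint pairs. Put $\mathcal{A}_{\mathcal{E}}=\mathbf{algebra}(\mathcal{E})$ and $\mathcal{U}_{\mathcal{E}}=\mathcal{A}_{\mathcal{E}}\setminus\{\emptyset\}$; for $A\in\mathcal{A}_{\mathcal{E}}$ let $\tilde A=\{B\in\mathcal{U}_{\mathcal{E}} : B\subseteq A\}$, and let $\mathbb{A}_{\mathcal{E}}=\mathbf{algebra}(\{\tilde A : A\in\mathcal{U}_{\mathcal{E}}\})$, an algebra of subsets of $\mathcal{U}_{\mathcal{E}}$. For an event $E$ and a non-empty $B\subseteq\Omega$ let $u_B(E)=\min_{\omega\in B}\mathbf{1}_E(\omega)$, which is $1$ if $B\subseteq E$ and $0$ otherwise. For a finite non-empty $\mathcal{F}\subseteq\mathcal{E}$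 let $\mathcal{C}_{\mathcal{F}}$ be the (finite) set of atoms of $\mathbf{algebra}(\mathcal{F})$. Then the following five statements are equivalent. (i) There is a finitely additive probability $P'$ on $\mathcal{A}_{\mathcal{E}}$ with $P'(E)=P(E)$ for every $E\in\mathcal{E}$. (ii) There is a finitely additive probability $\mu$ on $\mathbb{A}_{\mathcal{E}}$ such that $A\mapsto\mu(\tilde A)$ is a finitely additive probability on $\mathcal{A}_{\mathcal{E}}$ and, for every $E\in\mathcal{E}$, $P(E)=\int_{\mathcal{U}_{\mathcal{E}}}u_B(E)\,\mu(\mathrm{d}B)$. Here the integral is the Stieltjes-type integral, that is, the limit, under refinement of finite partitions of $\mathcal{U}_{\mathcal{E}}$ into non-empty members $X_1,\dots,X_k$ of $\mathbb{A}_{\mathcal{E}}$, of the sums $\sum_j u_{B_j}(E)\,\mu(X_j)$ with arbitrary $B_j\in X_j$. (iii) For every finite non-empty $\mathcal{F}=\{E_1,\dots,E_n\}\subseteq\mathcal{E}$ there are real numbers $x_C\ge 0$ ($C\in\mathcal{C}_{\mathcal{F}}$) with $\sum_{C\in\mathcal{C}_{\mathcal{F}}}x_C=1$ and $\sum_{C\in\mathcal{C}_{\mathcal{F}}}u_C(E_i)\,x_C=P(E_i)$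 for $i=1,\dots,n$. (iv) For every finite non-empty $\mathcal{F}=\{E_1,\dots,E_n\}\subseteq\mathcal{E}$ and all $\lambda_1,\dots,\lambda_n\in\mathbb{R}$, $$\max_{C\in\mathcal{C}_{\mathcal{F}}}\ \sum_{i=1}^n\lambda_i\bigl(u_C(E_i)-P(E_i)\bigr)\ \ge\ 0 .$$ (v) For every finite non-empty $\mathcal{F}=\{E_1,\dots,E_n\}\subseteq\mathcal{E}$ there is no function $P^*:\mathcal{F}\to[0,1]$, different from the restriction of $P$ to $\mathcal{F}$, such that for every $C\in\mathcal{C}_{\mathcal{F}}$ $$\sum_{i=1}^n\bigl(u_C(E_i)-P^*(E_i)\bigr)^2<\sum_{i=1}^n\bigl(u_C(E_i)-P(E_i)\bigr)^2 .$$ -/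

import Mathlib

open MeasureTheory

namespace Coherence

/-- `μ` is a finitely additive probability on the algebra of sets `𝒜`. The set function is written
as a total function; only its values on `𝒜` matter. -/
structure IsFinAddProb {α : Type*} (𝒜 : Set (Set α)) (μ : Set α → ℝ) : Prop where
  mem_Icc : ∀ A ∈ 𝒜, μ A ∈ Set.Icc (0 : ℝ) 1
  univ : μ Set.univ = 1
  union : ∀ A ∈ 𝒜, ∀ B ∈ 𝒜, Disjoint A B → μ (A ∪ B) = μ A + μ B

/-- `π` is a finite partition of the whole space into non-empty members of `𝒜`. -/
def IsFinPartition {α : Type*} (𝒜 : Set (Set α)) (π : Finset (Set α)) : Prop :=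
  (π : Set (Set α)) ⊆ 𝒜 ∧ Setoid.IsPartition (π : Set (Set α))

/-- `f` has Stieltjes-type integral `I` with respect to the finitely additive `μ` on `𝒜`: the sums
`∑ f (tag A) * μ A` over tagged finite partitions in `𝒜` converge to `I` along refinement. -/
def HasStieltjesIntegral {α : Type*} (𝒜 : Set (Set α)) (μ : Set α → ℝ) (f : α → ℝ) (I : ℝ) :
    Prop :=
  ∀ ε : ℝ, 0 < ε → ∃ π : Finset (Set α), IsFinPartition 𝒜 π ∧
    ∀ ρ : Finset (Set α), IsFinPartition 𝒜 ρ → (∀ A ∈ ρ, ∃ B ∈ π, A ⊆ B) →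
      ∀ tag : Set α → α, (∀ A ∈ ρ, tag A ∈ A) → |∑ A ∈ ρ, f (tag A) * μ A - I| < ε

/-- The generalized indicator `min_{ω ∈ B} 1_E(ω)` (used for non-empty `B` only). -/
noncomputable def minInd {Ω : Type*} (E B : Set Ω) : ℝ :=
  ⨅ ω : B, E.indicator (fun _ => (1 : ℝ)) (ω : Ω)

/-- The infimum in `minInd` is a minimum. -/
theorem isLeast_minInd {Ω : Type*} (E : Set Ω) {B : Set Ω} (hB : B.Nonempty) :
    IsLeast ((E.indicator fun _ => (1 : ℝ)) '' B) (minInd E B) := by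
  have hfin : ((E.indicator fun _ => (1 : ℝ)) '' B).Finite := by
    refine (Set.toFinite ({0, 1} : Set ℝ)).subset ?_
    rintro _ ⟨ω, -, rfl⟩
    by_cases h : ω ∈ E <;> simp [h]
  have hne : ((E.indicator fun _ => (1 : ℝ)) '' B).Nonempty := hB.image _
  have h : minInd E B = sInf ((E.indicator fun _ => (1 : ℝ)) '' B) := by
    rw [sInf_image']
    rfl
  rw [h]
  exact ⟨hne.csInf_mem hfin, fun _ hx => csInf_le hfin.bddBelow hx⟩

/-- For a non-empty set `B` the generalized indicator is `1` if `B ⊆ E` and `0` otherwise. -/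
theorem minInd_eq {Ω : Type*} (E : Set Ω) {B : Set Ω} (hB : B.Nonempty) [Decidable (B ⊆ E)] :
    minInd E B = if B ⊆ E then 1 else 0 := by
  obtain ⟨⟨ω, hω, h1⟩, h2⟩ := isLeast_minInd E hB
  split_ifs with h
  · rw [← h1, Set.indicator_of_mem (h hω)]
  · obtain ⟨x, hx, hxE⟩ := Set.not_subset.1 h
    have h3 := h2 ⟨x, hx, rfl⟩
    rw [Set.indicator_of_notMem hxE] at h3
    refine le_antisymm h3 ?_
    rw [← h1]
    exact Set.indicator_nonneg (fun _ _ => zero_le_one) _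

/-- The atoms of an algebra of sets: its minimal non-empty members. -/
def atoms {Ω : Type*} (𝒜 : Set (Set Ω)) : Set (Set Ω) :=
  {C | Minimal (fun B => B ∈ 𝒜 ∧ B.Nonempty) C}

/-- The algebra generated by finitely many events has finitely many atoms. -/
theorem finite_atoms {Ω : Type*} {𝒢 : Set (Set Ω)} (h𝒢 : 𝒢.Finite) :
    (atoms (generateSetAlgebra 𝒢)).Finite := by
  have halg : IsSetAlgebra (generateSetAlgebra 𝒢) := isSetAlgebra_generateSetAlgebra
  -- an atom is contained in, or disjoint from, each member of the algebra
  have key : ∀ C ∈ atoms (generateSetAlgebra 𝒢), ∀ s ∈ generateSetAlgebra 𝒢,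
      ∀ ω ∈ C, ω ∈ s → C ⊆ s := by
    intro C hC s hs ω hωC hωs
    have := hC.2 (y := C ∩ s) ⟨halg.inter_mem hC.1.1 hs, ω, hωC, hωs⟩ Set.inter_subset_left
    exact fun x hx => (this hx).2
  refine Set.Finite.of_finite_image (f := fun C => {E ∈ 𝒢 | C ⊆ E})
    (h𝒢.finite_subsets.subset ?_) ?_
  · rintro _ ⟨C, -, rfl⟩
    exact Set.sep_subset _ _
  · intro C hC D hD hCD
    obtain ⟨c, hc⟩ := hC.1.2
    obtain ⟨d, hd⟩ := hD.1.2
    have agree : ∀ s ∈ generateSetAlgebra 𝒢, (c ∈ s ↔ d ∈ s) := by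
      intro s hs
      induction hs with
      | base s hs =>
        have h1 := Set.ext_iff.1 hCD s
        simp only [Set.mem_sep_iff, hs, true_and] at h1
        have hsg := generateSetAlgebra.base s hs
        exact ⟨fun h => h1.1 (key C hC s hsg c hc h) hd, fun h => h1.2 (key D hD s hsg d hd h) hc⟩
      | empty => simp
      | compl s _ ih => simp [ih]
      | union s t _ _ ih1 ih2 => simp [ih1, ih2]
    exact Set.Subset.antisymm (key C hC D hD.1.1 c hc ((agree D hD.1.1).2 hd))
      (key D hD C hC.1.1 d hd ((agree C hC.1.1).1 hc))

section Assessment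

variable {Ω : Type*} {ℰ : Set (Set Ω)}

/-- The algebra generated by a finite set `F` of events from `ℰ`. -/
def finAlgebra (F : Finset ℰ) : Set (Set Ω) :=
  generateSetAlgebra ((fun E : ℰ => (E : Set Ω)) '' (F : Set ℰ))

/-- The finite set of atoms generated by a finite set `F` of events from `ℰ`. -/
noncomputable def finAtoms (F : Finset ℰ) : Finset (Set Ω) :=
  (finite_atoms (F.finite_toSet.image fun E : ℰ => (E : Set Ω)) :
    (atoms (finAlgebra F)).Finite).toFinset

/-- The non-empty members of the algebra generated by `ℰ`. -/
def nonemptyEvents (ℰ : Set (Set Ω)) : Set (Set Ω) :=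
  {B | B ∈ generateSetAlgebra ℰ ∧ B.Nonempty}

/-- The set of all non-empty members `B` of the algebra generated by `ℰ` with `B ⊆ A`. -/
def tilde (ℰ : Set (Set Ω)) (A : Set Ω) : Set (nonemptyEvents ℰ) :=
  {B | (B : Set Ω) ⊆ A}

/-- The algebra, on the set of non-empty members of the algebra generated by `ℰ`, that is generated
by the sets `tilde ℰ A`. -/
def tildeAlgebra (ℰ : Set (Set Ω)) : Set (Set (nonemptyEvents ℰ)) :=
  generateSetAlgebra (tilde ℰ '' nonemptyEvents ℰ)

/-- `P` extends to a finitely additive probability on the algebra generated by `ℰ`. -/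
def Coherent1P (P : ℰ → unitInterval) : Prop :=
  ∃ P' : Set Ω → ℝ, IsFinAddProb (generateSetAlgebra ℰ) P' ∧ ∀ E : ℰ, (P E : ℝ) = P' E

/-- Integral representation of `P`. -/
def Coherent2P (P : ℰ → unitInterval) : Prop :=
  ∃ μ : Set (nonemptyEvents ℰ) → ℝ, IsFinAddProb (tildeAlgebra ℰ) μ ∧
    IsFinAddProb (generateSetAlgebra ℰ) (fun A => μ (tilde ℰ A)) ∧
    ∀ E : ℰ, HasStieltjesIntegral (tildeAlgebra ℰ) μ (fun B => minInd (E : Set Ω) B) (P E)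

/-- Compatibility of all the linear systems on atoms. -/
def Coherent3P (P : ℰ → unitInterval) : Prop :=
  ∀ F : Finset ℰ, F.Nonempty → ∃ x : Set Ω → ℝ,
    (∀ E ∈ F, ∑ C ∈ finAtoms F, minInd (E : Set Ω) C * x C = P E) ∧
    ∑ C ∈ finAtoms F, x C = 1 ∧
    ∀ C ∈ finAtoms F, 0 ≤ x C

/-- The gain, on the atom `C`, of the bets on the events in `F` with stakes `stake` and prices
`P`. -/
noncomputable def gain (P : ℰ → unitInterval) (F : Finset ℰ) (stake : F → ℝ) (C : Set Ω) : ℝ :=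
  ∑ E : F, stake E * (minInd (E : Set Ω) C - P E)

/-- Betting criterion: no combination of finitely many bets has a uniformly negative gain. -/
def Coherent4P (P : ℰ → unitInterval) : Prop :=
  ∀ F : Finset ℰ, F.Nonempty → ∀ stake : F → ℝ,
    ∃ M : ℝ, IsGreatest (gain P F stake '' (finAtoms F : Set (Set Ω))) M ∧ 0 ≤ M

/-- The Brier penalty, on the atom `C`, of an assessment `Q` on `F`. -/
noncomputable def penalty (F : Finset ℰ) (Q : F → unitInterval) (C : Set Ω) : ℝ :=
  ∑ E : F, (minInd (E : Set Ω) C - Q E) ^ 2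

/-- Penalty criterion: no distinct assessment on a finite `F` has uniformly smaller penalty than
the restriction of `P` to `F`. -/
def Coherent5P (P : ℰ → unitInterval) : Prop :=
  ∀ F : Finset ℰ, F.Nonempty → ¬ ∃ Q : F → unitInterval, Q ≠ (fun E : F => P E) ∧
    ∀ C ∈ finAtoms F, penalty F Q C < penalty F (fun E : F => P E) C

end Assessment

end Coherence

/-! For (i) and (ii): as a function of `B`, the integrand `minInd E B` is the indicator of `tilde ℰ
E`, so its integral is `μ (tilde ℰ E)`, and (ii) gives (i) at once. Conversely, each point `ω`
defines a filter on the non-empty events, generated by the families of all events `B` with `ω ∈ B ⊆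
B₀`. On `tildeAlgebra ℰ` this filter decides every set, so `germ S`, the points whose filter
contains `S`, is a Boolean homomorphism with `germ (tilde ℰ A) = A`. Hence `P' ∘ germ` is the
required `μ` (`germ_mem_and_compl`).

For (i) and (iii): an extension supplies the weights of the atoms. Conversely, weights on atoms
become Dirac masses at points of the atoms, and an ultralimit over finite `F` glues these local
solutions (`exists_isFinAddProb_of_finite`).

For (iii), (iv) and (v): (iii) says that the price vector `p` is in the convex hull of the vectors
`u_C`. If not, its projection `q` onto the hull gives losing stakes `p - q` and a dominating
assessment `q` (`exists_weights_or_separation`). If so, averaging over the weights gives gain zero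
and a non-negative change of penalty, so some atom refutes uniform loss or domination. -/

namespace Coherence

/-! ### Finitely additive probabilities -/

section FinAdd

variable {α : Type*} {𝒜 : Set (Set α)} {μ : Set α → ℝ}

theorem IsFinAddProb.empty (hμ : IsFinAddProb 𝒜 μ) (h𝒜 : IsSetAlgebra 𝒜) : μ ∅ = 0 := by
  have h := hμ.union ∅ h𝒜.empty_mem ∅ h𝒜.empty_mem (by simp)
  simp only [Set.union_self] at h
  linarith

theorem IsFinAddProb.mono (hμ : IsFinAddProb 𝒜 μ) {ℬ : Set (Set α)} (h : ℬ ⊆ 𝒜) :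
    IsFinAddProb ℬ μ :=
  ⟨fun A hA => hμ.mem_Icc A (h hA), hμ.univ, fun A hA B hB => hμ.union A (h hA) B (h hB)⟩

theorem IsFinAddProb.biUnion (hμ : IsFinAddProb 𝒜 μ) (h𝒜 : IsSetAlgebra 𝒜)
    (t : Finset (Set α)) (ht : ∀ A ∈ t, A ∈ 𝒜)
    (hd : (t : Set (Set α)).PairwiseDisjoint id) :
    μ (⋃ A ∈ t, A) = ∑ A ∈ t, μ A := by
  classical
  induction t using Finset.induction_on with
  | empty => simpa using hμ.empty h𝒜
  | insert a t ha ih =>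
    have ht' : ∀ A ∈ t, A ∈ 𝒜 := fun A hA => ht A (Finset.mem_insert_of_mem hA)
    rw [Finset.sum_insert ha, Finset.set_biUnion_insert,
      hμ.union a (ht a (Finset.mem_insert_self a t)) _ (h𝒜.biUnion_mem t ht'),
      ih ht' (hd.subset (by simp))]
    rw [Set.disjoint_iUnion₂_right]
    intro B hB
    exact hd (by simp) (by simp [hB]) (fun h => ha (h ▸ hB))

/-- If the cells of a disjoint finite family that are included in `T` cover `T`, their
probabilities sum up to that of `T`. -/
theorem IsFinAddProb.sum_ite_subset (hμ : IsFinAddProb 𝒜 μ) (h𝒜 : IsSetAlgebra 𝒜)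
    (t : Finset (Set α)) (ht : ∀ A ∈ t, A ∈ 𝒜)
    (hd : (t : Set (Set α)).PairwiseDisjoint id) (T : Set α) [DecidablePred (· ⊆ T)]
    (hT : ∀ x ∈ T, ∃ A ∈ t, x ∈ A ∧ A ⊆ T) :
    ∑ A ∈ t, (if A ⊆ T then μ A else 0) = μ T := by
  rw [← Finset.sum_filter, ← hμ.biUnion h𝒜 _ (fun A hA => ht A (Finset.mem_filter.1 hA).1)
    (hd.subset (Finset.coe_subset.2 (Finset.filter_subset _ _)))]
  congr 1
  ext x
  simp only [Set.mem_iUnion, Finset.mem_filter, exists_prop]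
  constructor
  · rintro ⟨A, ⟨-, hA⟩, hx⟩
    exact hA hx
  · intro hx
    obtain ⟨A, hA, hxA, hAT⟩ := hT x hx
    exact ⟨A, ⟨hA, hAT⟩, hxA⟩

/-- The weighted sum of Dirac masses at the points `pt C`. -/
theorem isFinAddProb_sum_dirac {κ : Type*} (s : Finset κ) (w : κ → ℝ) (hw : ∀ C ∈ s, 0 ≤ w C)
    (hw1 : ∑ C ∈ s, w C = 1) (pt : κ → α) :
    IsFinAddProb 𝒜 (fun A => ∑ C ∈ s, A.indicator (fun _ => (1 : ℝ)) (pt C) * w C) where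
  mem_Icc A _ := by
    refine ⟨Finset.sum_nonneg fun C hC => mul_nonneg
      (Set.indicator_nonneg (fun _ _ => zero_le_one) _) (hw C hC), ?_⟩
    refine (Finset.sum_le_sum fun C hC => mul_le_of_le_one_left (hw C hC) ?_).trans hw1.le
    exact Set.indicator_le_self' (f := fun _ => (1 : ℝ)) (fun _ _ => zero_le_one) _
  univ := by simpa using hw1
  union A _ B _ hAB := by
    simp only [← Finset.sum_add_distrib, ← add_mul, Set.indicator_union_of_disjoint hAB]

/-- Compactness: a probability assessment that is extendable on every finite set of events is
extendable. -/
theorem exists_isFinAddProb_of_finite {ι : Type*} (ev : ι → Set α) (p : ι → ℝ)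
    (h : ∀ F : Finset ι, ∃ Q : Set α → ℝ, IsFinAddProb Set.univ Q ∧ ∀ i ∈ F, p i = Q (ev i)) :
    ∃ Q : Set α → ℝ, IsFinAddProb Set.univ Q ∧ ∀ i, p i = Q (ev i) := by
  classical
  choose Q hQ hQp using h
  -- By compactness of `[0, 1]`, all events have limits along one ultrafilter, and finite additivity
  -- passes to the limit. Since it refines `atTop`, each `i` eventually lies in `F`, so the
  -- prescribed value survives.
  let 𝒰 : Ultrafilter (Finset ι) := Ultrafilter.of Filter.atTop
  have h𝒰 : (𝒰 : Filter (Finset ι)) ≤ Filter.atTop := Ultrafilter.of_le _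
  have hlim : ∀ A : Set α, ∃ l ∈ Set.Icc (0 : ℝ) 1,
      Filter.Tendsto (fun F => Q F A) 𝒰 (nhds l) := fun A =>
    isCompact_Icc.ultrafilter_le_nhds (𝒰.map fun F => Q F A)
      (Filter.le_principal_iff.2 (Filter.mem_map.2
        (Filter.univ_mem' fun F => (hQ F).mem_Icc A trivial)))
  choose L hL hLt using hlim
  refine ⟨L, ⟨fun A _ => hL A, ?_, fun A _ B _ hAB => ?_⟩, fun i => ?_⟩
  · refine tendsto_nhds_unique (hLt _) ?_
    simp only [(hQ _).univ]
    exact tendsto_const_nhds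
  · refine tendsto_nhds_unique (hLt _) ?_
    simp only [fun F => (hQ F).union A trivial B trivial hAB]
    exact (hLt A).add (hLt B)
  · refine tendsto_nhds_unique ?_ (hLt (ev i))
    refine Filter.Tendsto.congr' ?_ tendsto_const_nhds
    filter_upwards [h𝒰 (Filter.mem_atTop {i})] with F hF
    exact hQp F i (hF (Finset.mem_singleton_self i))

end FinAdd

/-! ### Finite partitions and the Stieltjes-type integral -/

section Partition

variable {α : Type*} {𝒜 : Set (Set α)}

theorem IsFinPartition.pairwiseDisjoint {π : Finset (Set α)} (hπ : IsFinPartition 𝒜 π) :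
    (π : Set (Set α)).PairwiseDisjoint id :=
  Setoid.eqv_classes_disjoint hπ.2.2

theorem IsFinPartition.exists_mem {π : Finset (Set α)} (hπ : IsFinPartition 𝒜 π) (x : α) :
    ∃ A ∈ π, x ∈ A := by
  obtain ⟨A, hA, -⟩ := hπ.2.2 x
  exact ⟨A, hA.1, hA.2⟩

theorem IsFinPartition.nonempty {π : Finset (Set α)} (hπ : IsFinPartition 𝒜 π) {A : Set α}
    (hA : A ∈ π) : A.Nonempty :=
  Setoid.nonempty_of_mem_partition hπ.2 hA

/-- The refinement of a finite partition by a set and its complement. -/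
theorem IsFinPartition.exists_refine (h𝒜 : IsSetAlgebra 𝒜) {π : Finset (Set α)}
    (hπ : IsFinPartition 𝒜 π) {T : Set α} (hT : T ∈ 𝒜) :
    ∃ ρ : Finset (Set α), IsFinPartition 𝒜 ρ ∧ (∀ A ∈ ρ, ∃ B ∈ π, A ⊆ B) ∧
      ∀ A ∈ ρ, A ⊆ T ∨ A ⊆ Tᶜ := by
  classical
  -- Cells of a partition are non-empty, so empty intersections are erased.
  have hmem : ∀ A, A ∈ (π.image (· ∩ T) ∪ π.image (· ∩ Tᶜ)).erase ∅ ↔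
      A ≠ ∅ ∧ ∃ B ∈ π, B ∩ T = A ∨ B ∩ Tᶜ = A := by
    intro A
    simp only [Finset.mem_erase, Finset.mem_union, Finset.mem_image]
    grind
  refine ⟨(π.image (· ∩ T) ∪ π.image (· ∩ Tᶜ)).erase ∅, ⟨?_, ?_, ?_⟩, ?_, ?_⟩
  · intro A hA
    obtain ⟨-, B, hB, rfl | rfl⟩ := (hmem A).1 hA
    · exact h𝒜.inter_mem (hπ.1 hB) hT
    · exact h𝒜.inter_mem (hπ.1 hB) (h𝒜.compl_mem hT)
  · simp
  · intro x
    obtain ⟨B, hB, hx⟩ := hπ.exists_mem x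
    have huniq : ∀ B' ∈ π, x ∈ B' → B' = B := fun B' hB' hx' =>
      (hπ.2.2 x).unique ⟨hB', hx'⟩ ⟨hB, hx⟩
    by_cases hxT : x ∈ T
    · refine ⟨B ∩ T, ⟨(hmem _).2 ⟨Set.Nonempty.ne_empty ⟨x, hx, hxT⟩, B, hB, Or.inl rfl⟩,
        hx, hxT⟩, ?_⟩
      rintro A ⟨hA, hxA⟩
      obtain ⟨-, B', hB', rfl | rfl⟩ := (hmem A).1 hA
      · rw [huniq B' hB' hxA.1]
      · exact absurd hxT hxA.2
    · refine ⟨B ∩ Tᶜ, ⟨(hmem _).2 ⟨Set.Nonempty.ne_empty ⟨x, hx, hxT⟩, B, hB, Or.inr rfl⟩,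
        hx, hxT⟩, ?_⟩
      rintro A ⟨hA, hxA⟩
      obtain ⟨-, B', hB', rfl | rfl⟩ := (hmem A).1 hA
      · exact absurd hxA.2 hxT
      · rw [huniq B' hB' hxA.1]
  · intro A hA
    obtain ⟨-, B, hB, rfl | rfl⟩ := (hmem A).1 hA
    · exact ⟨B, hB, Set.inter_subset_left⟩
    · exact ⟨B, hB, Set.inter_subset_left⟩
  · intro A hA
    obtain ⟨-, B, hB, rfl | rfl⟩ := (hmem A).1 hA
    · exact Or.inl Set.inter_subset_right
    · exact Or.inr Set.inter_subset_right

theorem isFinPartition_singleton_univ [Nonempty α] (h𝒜 : IsSetAlgebra 𝒜) :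
    IsFinPartition 𝒜 {Set.univ} := by
  refine ⟨by simpa using h𝒜.univ_mem, ?_, fun x => ⟨Set.univ, by simp, by simp⟩⟩
  simpa using Set.empty_ne_univ

variable {μ : Set α → ℝ}

/-- Once every cell lies inside or outside `T`, the choice of tags is immaterial: the sum is the
total mass of the cells inside `T`. -/
theorem sum_indicator_tag (hμ : IsFinAddProb 𝒜 μ) (h𝒜 : IsSetAlgebra 𝒜) {ρ : Finset (Set α)}
    (hρ : IsFinPartition 𝒜 ρ) {T : Set α} (hT : ∀ A ∈ ρ, A ⊆ T ∨ A ⊆ Tᶜ) {tag : Set α → α}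
    (htag : ∀ A ∈ ρ, tag A ∈ A) :
    ∑ A ∈ ρ, T.indicator (fun _ => (1 : ℝ)) (tag A) * μ A = μ T := by
  classical
  rw [← hμ.sum_ite_subset h𝒜 ρ hρ.1 hρ.pairwiseDisjoint T]
  · refine Finset.sum_congr rfl fun A hA => ?_
    split_ifs with h
    · rw [Set.indicator_of_mem (h (htag A hA)), one_mul]
    · rw [Set.indicator_of_notMem (((hT A hA).resolve_left h) (htag A hA)), zero_mul]
  · intro x hx
    obtain ⟨A, hA, hxA⟩ := hρ.exists_mem x
    exact ⟨A, hA, hxA, (hT A hA).resolve_right fun h => h hxA hx⟩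

/-- The indicator of a member `T` of the algebra has integral `I` if and only if `I = μ T`. -/
theorem hasStieltjesIntegral_indicator_iff [Nonempty α] (hμ : IsFinAddProb 𝒜 μ)
    (h𝒜 : IsSetAlgebra 𝒜) {T : Set α} (hT : T ∈ 𝒜) (I : ℝ) :
    HasStieltjesIntegral 𝒜 μ (T.indicator fun _ => (1 : ℝ)) I ↔ I = μ T := by
  classical
  constructor
  · intro h
    refine (eq_of_forall_dist_le fun ε hε => ?_).symm
    obtain ⟨π, hπ, hsum⟩ := h ε hε
    obtain ⟨ρ, hρ, hρπ, hρT⟩ := hπ.exists_refine h𝒜 hT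
    have htag : ∀ A ∈ ρ, Classical.epsilon (· ∈ A) ∈ A := fun A hA =>
      Classical.epsilon_spec (hρ.nonempty hA)
    have := hsum ρ hρ hρπ (fun A => Classical.epsilon (· ∈ A)) htag
    rw [sum_indicator_tag hμ h𝒜 hρ hρT htag] at this
    exact this.le
  · rintro rfl ε hε
    obtain ⟨π, hπ, -, hπT⟩ := (isFinPartition_singleton_univ h𝒜).exists_refine h𝒜 hT
    refine ⟨π, hπ, fun ρ hρ hρπ tag htag => ?_⟩
    rw [sum_indicator_tag hμ h𝒜 hρ _ htag]
    · simpa using hε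
    · intro A hA
      obtain ⟨B, hB, hAB⟩ := hρπ A hA
      exact (hπT B hB).imp hAB.trans hAB.trans

end Partition

/-! ### Atoms of finitely generated algebras -/

section Atoms

variable {Ω : Type*}

theorem subset_of_mem_atoms {𝒜 : Set (Set Ω)} (h𝒜 : IsSetAlgebra 𝒜) {C A : Set Ω}
    (hC : C ∈ atoms 𝒜) (hA : A ∈ 𝒜) {ω : Ω} (hωC : ω ∈ C) (hωA : ω ∈ A) : C ⊆ A :=
  (hC.2 (y := C ∩ A) ⟨h𝒜.inter_mem hC.1.1 hA, ω, hωC, hωA⟩ Set.inter_subset_left).trans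
    Set.inter_subset_right

/-- The atom through `ω` is the intersection, over the generators `E`, of whichever of `E` and `Eᶜ`
contains `ω`. No generator separates its points, hence no member of the algebra does, which gives
minimality. -/
theorem exists_mem_atoms {𝒢 : Set (Set Ω)} (h𝒢 : 𝒢.Finite) (ω : Ω) :
    ∃ C ∈ atoms (generateSetAlgebra 𝒢), ω ∈ C := by
  classical
  have halg : IsSetAlgebra (generateSetAlgebra 𝒢) := isSetAlgebra_generateSetAlgebra
  let C : Set Ω := ⋂ E ∈ h𝒢.toFinset, if ω ∈ E then E else Eᶜ
  have hC : ∀ x, x ∈ C ↔ ∀ E ∈ 𝒢, (x ∈ E ↔ ω ∈ E) := by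
    intro x
    simp only [C, Set.mem_iInter, Set.Finite.mem_toFinset]
    refine forall₂_congr fun E _ => ?_
    split_ifs with h <;> simp [h]
  have hagree : ∀ s ∈ generateSetAlgebra 𝒢, ∀ x ∈ C, (x ∈ s ↔ ω ∈ s) := by
    intro s hs x hx
    induction hs with
    | base s hs => exact (hC x).1 hx s hs
    | empty => simp
    | compl s _ ih => simp [ih]
    | union s t _ _ ih1 ih2 => simp [ih1, ih2]
  have hωC : ω ∈ C := (hC ω).2 fun _ _ => Iff.rfl
  refine ⟨C, ⟨⟨halg.biInter_mem _ fun E hE => ?_, ω, hωC⟩, ?_⟩, hωC⟩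
  · have hE' := generateSetAlgebra.base E (h𝒢.mem_toFinset.1 hE)
    split_ifs
    · exact hE'
    · exact generateSetAlgebra.compl E hE'
  · rintro B ⟨hB, x, hxB⟩ hBC y hy
    exact (hagree B hB y hy).2 ((hagree B hB x (hBC hxB)).1 hxB)

variable {ℰ : Set (Set Ω)} (F : Finset ℰ)

theorem isSetAlgebra_finAlgebra : IsSetAlgebra (finAlgebra F) :=
  isSetAlgebra_generateSetAlgebra

theorem finAlgebra_subset : finAlgebra F ⊆ generateSetAlgebra ℰ := by
  refine generateSetAlgebra_mono ?_
  rintro _ ⟨E, -, rfl⟩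
  exact E.2

theorem mem_finAlgebra {F : Finset ℰ} {E : ℰ} (hE : E ∈ F) : (E : Set Ω) ∈ finAlgebra F :=
  generateSetAlgebra.base _ ⟨E, hE, rfl⟩

theorem mem_finAtoms {F : Finset ℰ} {C : Set Ω} : C ∈ finAtoms F ↔ C ∈ atoms (finAlgebra F) :=
  Set.Finite.mem_toFinset _

theorem nonempty_of_mem_finAtoms {F : Finset ℰ} {C : Set Ω} (hC : C ∈ finAtoms F) : C.Nonempty :=
  (mem_finAtoms.1 hC).1.2

theorem exists_mem_finAtoms (ω : Ω) : ∃ C ∈ finAtoms F, ω ∈ C := by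
  obtain ⟨C, hC, hω⟩ := exists_mem_atoms (F.finite_toSet.image fun E : ℰ => (E : Set Ω)) ω
  exact ⟨C, mem_finAtoms.2 hC, hω⟩

theorem finAtoms_nonempty [Nonempty Ω] : (finAtoms F).Nonempty := by
  obtain ⟨C, hC, -⟩ := exists_mem_finAtoms F (Classical.arbitrary Ω)
  exact ⟨C, hC⟩

theorem pairwiseDisjoint_finAtoms : (finAtoms F : Set (Set Ω)).PairwiseDisjoint id := by
  intro C hC D hD hCD
  refine Set.disjoint_left.2 fun ω hωC hωD => hCD ?_
  have hC' := mem_finAtoms.1 hC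
  have hD' := mem_finAtoms.1 hD
  exact (subset_of_mem_atoms (isSetAlgebra_finAlgebra F) hC' hD'.1.1 hωC hωD).antisymm
    (subset_of_mem_atoms (isSetAlgebra_finAlgebra F) hD' hC'.1.1 hωD hωC)

/-- `A` is the disjoint union of the atoms it contains, and `minInd A` selects exactly these. -/
theorem sum_minInd_finAtoms {μ : Set Ω → ℝ} (hμ : IsFinAddProb (finAlgebra F) μ) {A : Set Ω}
    (hA : A ∈ finAlgebra F) : ∑ C ∈ finAtoms F, minInd A C * μ C = μ A := by
  classical
  rw [← hμ.sum_ite_subset (isSetAlgebra_finAlgebra F) (finAtoms F)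
    (fun C hC => (mem_finAtoms.1 hC).1.1) (pairwiseDisjoint_finAtoms F) A]
  · refine Finset.sum_congr rfl fun C hC => ?_
    rw [minInd_eq A (nonempty_of_mem_finAtoms hC)]
    split_ifs <;> simp
  · intro ω hω
    obtain ⟨C, hC, hωC⟩ := exists_mem_finAtoms F ω
    exact ⟨C, hC, hωC,
      subset_of_mem_atoms (isSetAlgebra_finAlgebra F) (mem_finAtoms.1 hC) hA hωC hω⟩

theorem minInd_eq_indicator {E : ℰ} (hE : E ∈ F) {C : Set Ω} (hC : C ∈ finAtoms F) {ω : Ω}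
    (hω : ω ∈ C) : minInd (E : Set Ω) C = (E : Set Ω).indicator (fun _ => (1 : ℝ)) ω := by
  classical
  rw [minInd_eq _ (nonempty_of_mem_finAtoms hC)]
  by_cases h : ω ∈ (E : Set Ω)
  · rw [Set.indicator_of_mem h, if_pos (subset_of_mem_atoms (isSetAlgebra_finAlgebra F)
      (mem_finAtoms.1 hC) (mem_finAlgebra hE) hω h)]
  · rw [Set.indicator_of_notMem h, if_neg fun hCE => h (hCE hω)]

theorem minInd_mem_Icc (E : Set Ω) {C : Set Ω} (hC : C.Nonempty) :
    minInd E C ∈ Set.Icc (0 : ℝ) 1 := by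
  classical
  rw [minInd_eq E hC]
  split_ifs <;> simp

end Atoms

/-! ### The integral representation -/

section Integral

variable {Ω : Type*} {ℰ : Set (Set Ω)}

theorem isSetAlgebra_tildeAlgebra : IsSetAlgebra (tildeAlgebra ℰ) :=
  isSetAlgebra_generateSetAlgebra

theorem tilde_empty : tilde ℰ (∅ : Set Ω) = ∅ := by
  ext B
  simpa [tilde, Set.subset_empty_iff] using B.2.2.ne_empty

theorem tilde_univ : tilde ℰ (Set.univ : Set Ω) = Set.univ := by
  ext B
  simp [tilde]

theorem tilde_mem_tildeAlgebra {A : Set Ω} (hA : A ∈ generateSetAlgebra ℰ) :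
    tilde ℰ A ∈ tildeAlgebra ℰ := by
  rcases A.eq_empty_or_nonempty with rfl | h
  · rw [tilde_empty]
    exact isSetAlgebra_tildeAlgebra.empty_mem
  · exact generateSetAlgebra.base _ ⟨A, ⟨hA, h⟩, rfl⟩

theorem minInd_eq_indicator_tilde (E : Set Ω) :
    (fun B : nonemptyEvents ℰ => minInd E B) = (tilde ℰ E).indicator fun _ => (1 : ℝ) := by
  classical
  ext B
  rw [minInd_eq E B.2.2, Set.indicator_apply]
  rfl

theorem nonempty_nonemptyEvents [Nonempty Ω] : Nonempty (nonemptyEvents ℰ) :=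
  ⟨⟨Set.univ, isSetAlgebra_generateSetAlgebra.univ_mem, Set.univ_nonempty⟩⟩

/-- The set of all points `ω` such that all sufficiently small members of the algebra generated by
`ℰ` that contain `ω` belong to `S`. -/
def germ (S : Set (nonemptyEvents ℰ)) : Set Ω :=
  {ω | ∃ B₀ ∈ generateSetAlgebra ℰ, ω ∈ B₀ ∧
    ∀ B : nonemptyEvents ℰ, ω ∈ (B : Set Ω) → (B : Set Ω) ⊆ B₀ → B ∈ S}

theorem germ_mono {S T : Set (nonemptyEvents ℰ)} (h : S ⊆ T) : germ S ⊆ germ T := by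
  rintro ω ⟨B₀, h₀, hω, hB⟩
  exact ⟨B₀, h₀, hω, fun B h1 h2 => h (hB B h1 h2)⟩

theorem germ_inter (S T : Set (nonemptyEvents ℰ)) : germ (S ∩ T) = germ S ∩ germ T := by
  refine (Set.subset_inter (germ_mono Set.inter_subset_left)
    (germ_mono Set.inter_subset_right)).antisymm ?_
  rintro ω ⟨⟨B, hB, hωB, h1⟩, D, hD, hωD, h2⟩
  refine ⟨B ∩ D, isSetAlgebra_generateSetAlgebra.inter_mem hB hD, ⟨hωB, hωD⟩, fun X hX hXs => ?_⟩
  exact ⟨h1 X hX (hXs.trans Set.inter_subset_left), h2 X hX (hXs.trans Set.inter_subset_right)⟩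

theorem germ_empty : germ (∅ : Set (nonemptyEvents ℰ)) = ∅ := by
  refine Set.eq_empty_of_forall_notMem ?_
  rintro ω ⟨B, hB, hω, h⟩
  exact h ⟨B, hB, ω, hω⟩ hω subset_rfl

theorem germ_univ : germ (Set.univ : Set (nonemptyEvents ℰ)) = Set.univ := by
  refine Set.eq_univ_of_forall fun ω => ?_
  exact ⟨Set.univ, isSetAlgebra_generateSetAlgebra.univ_mem, trivial, fun _ _ _ => trivial⟩

theorem germ_tilde {A : Set Ω} (hA : A ∈ generateSetAlgebra ℰ) : germ (tilde ℰ A) = A := by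
  ext ω
  constructor
  · rintro ⟨B, hB, hω, h⟩
    exact h ⟨B, hB, ω, hω⟩ hω subset_rfl hω
  · exact fun hω => ⟨A, hA, hω, fun B _ hB => hB⟩

/-- An event around a point of `A` can be shrunk into `A` by intersection, while no event containing
a point outside `A` is included in `A`. -/
theorem germ_compl_tilde {A : Set Ω} (hA : A ∈ generateSetAlgebra ℰ) :
    germ (tilde ℰ A)ᶜ = Aᶜ := by
  ext ω
  constructor
  · rintro ⟨B, hB, hω, h⟩ hωA
    exact h ⟨B ∩ A, isSetAlgebra_generateSetAlgebra.inter_mem hB hA, ω, hω, hωA⟩ ⟨hω, hωA⟩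
      Set.inter_subset_left Set.inter_subset_right
  · exact fun hω => ⟨Set.univ, isSetAlgebra_generateSetAlgebra.univ_mem, trivial,
      fun B hωB _ hBA => hω (hBA hωB)⟩

/-- Compatibility with complements holds on generators and propagates by induction, since `germ`
preserves all intersections. -/
theorem germ_mem_and_compl {S : Set (nonemptyEvents ℰ)} (hS : S ∈ tildeAlgebra ℰ) :
    germ S ∈ generateSetAlgebra ℰ ∧ germ Sᶜ = (germ S)ᶜ := by
  have halg : IsSetAlgebra (generateSetAlgebra ℰ) := isSetAlgebra_generateSetAlgebra
  induction hS with
  | base S hS =>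
    obtain ⟨A, hA, rfl⟩ := hS
    rw [germ_compl_tilde hA.1, germ_tilde hA.1]
    exact ⟨hA.1, rfl⟩
  | empty =>
    rw [Set.compl_empty, germ_univ, germ_empty, Set.compl_empty]
    exact ⟨halg.empty_mem, rfl⟩
  | compl S _ ih =>
    rw [compl_compl, ih.2, compl_compl]
    exact ⟨halg.compl_mem ih.1, rfl⟩
  | union S T _ _ ihS ihT =>
    have h : germ (S ∪ T) = germ S ∪ germ T := by
      refine Set.Subset.antisymm (fun ω hω => ?_)
        (Set.union_subset (germ_mono Set.subset_union_left) (germ_mono Set.subset_union_right))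
      -- A point in neither germ lies in the germs of both complements, hence in the germ of `(S ∪
      -- T) ∩ (S ∪ T)ᶜ`, which is empty.
      by_contra hn
      simp only [Set.mem_union, not_or] at hn
      rw [← Set.mem_compl_iff, ← ihS.2, ← Set.mem_compl_iff, ← ihT.2, ← Set.mem_inter_iff,
        ← germ_inter, ← Set.compl_union] at hn
      have h2 : ω ∈ germ ((S ∪ T) ∩ (S ∪ T)ᶜ) := by
        rw [germ_inter]
        exact ⟨hω, hn⟩
      rw [Set.inter_compl_self, germ_empty] at h2
      exact h2
    rw [Set.compl_union, germ_inter, ihS.2, ihT.2, h, Set.compl_union]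
    exact ⟨halg.union_mem ihS.1 ihT.1, rfl⟩

theorem germ_union {S T : Set (nonemptyEvents ℰ)} (hS : S ∈ tildeAlgebra ℰ)
    (hT : T ∈ tildeAlgebra ℰ) : germ (S ∪ T) = germ S ∪ germ T := by
  have h := (germ_mem_and_compl (isSetAlgebra_tildeAlgebra.union_mem hS hT)).2
  rw [Set.compl_union, germ_inter, (germ_mem_and_compl hS).2, (germ_mem_and_compl hT).2,
    ← Set.compl_union] at h
  exact (compl_injective h).symm

theorem IsFinAddProb.comp_germ {μ : Set Ω → ℝ} (hμ : IsFinAddProb (generateSetAlgebra ℰ) μ) :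
    IsFinAddProb (tildeAlgebra ℰ) (fun S => μ (germ S)) where
  mem_Icc S hS := hμ.mem_Icc _ (germ_mem_and_compl hS).1
  univ := by rw [germ_univ, hμ.univ]
  union S hS T hT hST := by
    rw [germ_union hS hT, hμ.union _ (germ_mem_and_compl hS).1 _ (germ_mem_and_compl hT).1]
    rw [Set.disjoint_iff_inter_eq_empty, ← germ_inter, hST.inter_eq, germ_empty]

theorem IsFinAddProb.congr {α : Type*} {𝒜 : Set (Set α)} {μ ν : Set α → ℝ}
    (hμ : IsFinAddProb 𝒜 μ) (h𝒜 : IsSetAlgebra 𝒜) (h : ∀ A ∈ 𝒜, ν A = μ A) :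
    IsFinAddProb 𝒜 ν where
  mem_Icc A hA := by rw [h A hA]; exact hμ.mem_Icc A hA
  univ := by rw [h _ h𝒜.univ_mem, hμ.univ]
  union A hA B hB hAB := by
    rw [h A hA, h B hB, h _ (h𝒜.union_mem hA hB), hμ.union A hA B hB hAB]

theorem coherent1P_iff_coherent2P [Nonempty Ω] (P : ℰ → unitInterval) :
    Coherent1P P ↔ Coherent2P P := by
  have := nonempty_nonemptyEvents (ℰ := ℰ)
  have hE (E : ℰ) : (E : Set Ω) ∈ generateSetAlgebra ℰ := generateSetAlgebra.base _ E.2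
  constructor
  · rintro ⟨P', hP', hext⟩
    refine ⟨fun S => P' (germ S), hP'.comp_germ,
      hP'.congr isSetAlgebra_generateSetAlgebra fun A hA =>
        congrArg P' (germ_tilde hA), fun E => ?_⟩
    rw [minInd_eq_indicator_tilde, hasStieltjesIntegral_indicator_iff hP'.comp_germ
      isSetAlgebra_tildeAlgebra (tilde_mem_tildeAlgebra (hE E)), germ_tilde (hE E)]
    exact hext E
  · rintro ⟨μ, hμ, hμ', hint⟩
    refine ⟨fun A => μ (tilde ℰ A), hμ', fun E => ?_⟩
    have h := hint E
    rwa [minInd_eq_indicator_tilde, hasStieltjesIntegral_indicator_iff hμ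
      isSetAlgebra_tildeAlgebra (tilde_mem_tildeAlgebra (hE E))] at h

end Integral

/-! ### Linear systems on the atoms -/

section LinearSystem

variable {Ω : Type*} {ℰ : Set (Set Ω)}

theorem Coherent1P.coherent3P {P : ℰ → unitInterval} (h : Coherent1P P) : Coherent3P P := by
  classical
  obtain ⟨P', hP', hext⟩ := h
  intro F _
  have hF := hP'.mono (finAlgebra_subset F)
  refine ⟨P', fun E hE => ?_, ?_, fun C hC => (hF.mem_Icc C (mem_finAtoms.1 hC).1.1).1⟩
  · rw [sum_minInd_finAtoms F hF (mem_finAlgebra hE), hext E]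
  · rw [← hF.univ, ← sum_minInd_finAtoms F hF (isSetAlgebra_finAlgebra F).univ_mem]
    refine Finset.sum_congr rfl fun C hC => ?_
    rw [minInd_eq _ (nonempty_of_mem_finAtoms hC), if_pos (Set.subset_univ C), one_mul]

theorem Coherent3P.coherent1P [Nonempty Ω] {P : ℰ → unitInterval} (h : Coherent3P P) :
    Coherent1P P := by
  classical
  have hfin (F : Finset ℰ) :
      ∃ Q : Set Ω → ℝ, IsFinAddProb Set.univ Q ∧ ∀ E ∈ F, (P E : ℝ) = Q E := by
    -- `Coherent3P` is silent on empty `F`, where any Dirac mass serves.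
    rcases F.eq_empty_or_nonempty with hF | hF
    · refine ⟨_, isFinAddProb_sum_dirac {()} (fun _ => 1) (by simp) (by simp)
        (fun _ => Classical.arbitrary Ω), ?_⟩
      simp [hF]
    · obtain ⟨x, hx, hx1, hx0⟩ := h F hF
      refine ⟨_, isFinAddProb_sum_dirac (finAtoms F) x hx0 hx1
        (fun C => Classical.epsilon (· ∈ C)), fun E hE => ?_⟩
      rw [← hx E hE]
      exact Finset.sum_congr rfl fun C hC => by
        rw [minInd_eq_indicator F hE hC (Classical.epsilon_spec (nonempty_of_mem_finAtoms hC))]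
  obtain ⟨Q, hQ, hQP⟩ := exists_isFinAddProb_of_finite (fun E : ℰ => (E : Set Ω))
    (fun E => (P E : ℝ)) hfin
  exact ⟨Q, hQ.mono (Set.subset_univ _), hQP⟩

end LinearSystem

/-! ### Separation from a polytope -/

section Separation

variable {ι κ : Type*} [Fintype ι]

/-- A point `p` either is a convex combination of the points `u C`, or its metric projection `q`
onto their convex hull yields a separating hyperplane and is nearer to all `u C` than `p` is. -/
theorem exists_weights_or_separation (s : Finset κ) (hs : s.Nonempty) (u : κ → ι → ℝ)
    (p : ι → ℝ) :
    ∃ x : κ → ℝ, (∀ C ∈ s, 0 ≤ x C) ∧ ∑ C ∈ s, x C = 1 ∧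
      ∀ q : ι → ℝ, (∀ i, q i = ∑ C ∈ s, u C i * x C) → q = p ∨ q ≠ p ∧
        (∀ C ∈ s, ∑ i, (p i - q i) * (u C i - p i) < 0) ∧
        ∀ C ∈ s, ∑ i, (u C i - q i) ^ 2 < ∑ i, (u C i - p i) ^ 2 := by
  classical
  let φ : (s → ℝ) →ₗ[ℝ] EuclideanSpace ℝ ι :=
    ∑ C : s, (LinearMap.proj C).smulRight (WithLp.toLp 2 (u C))
  have hφ : ∀ w i, φ w i = ∑ C : s, u C i * w C := by
    intro w i
    simp [φ, mul_comm]
  let K : Set (EuclideanSpace ℝ ι) := φ '' stdSimplex ℝ s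
  have hsne : Nonempty s := hs.to_subtype
  have hK : IsCompact K := (isCompact_stdSimplex ℝ s).image φ.continuous_of_finiteDimensional
  have hconv : Convex ℝ K := (convex_stdSimplex ℝ s).linear_image φ
  have huK : ∀ C : s, WithLp.toLp 2 (u C) ∈ K := fun C =>
    ⟨Pi.single C 1, single_mem_stdSimplex ℝ C, by ext i; simp [hφ, Pi.single_apply]⟩
  obtain ⟨v, hv, hmin⟩ := exists_norm_eq_iInf_of_complete_convex
    ⟨_, huK (Classical.arbitrary s)⟩ hK.isComplete hconv (WithLp.toLp 2 p)
  -- Variational form of the projection: `⟪p - q, y - q⟫ ≤ 0` for all `y` in the hull.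
  rw [norm_eq_iInf_iff_real_inner_le_zero hconv hv] at hmin
  obtain ⟨w, hw, rfl⟩ := hv
  refine ⟨fun C => if h : C ∈ s then w ⟨C, h⟩ else 0, fun C hC => ?_, ?_, fun q hq => ?_⟩
  · simpa [hC] using hw.1 ⟨C, hC⟩
  · rw [← Finset.sum_coe_sort, ← hw.2]
    exact Finset.sum_congr rfl fun C _ => by simp
  have hqw : ∀ i, φ w i = q i := by
    intro i
    rw [hq, ← Finset.sum_coe_sort, hφ]
    exact Finset.sum_congr rfl fun C _ => by simp
  by_cases hqp : q = p
  · exact Or.inl hqp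
  refine Or.inr ⟨hqp, ?_⟩
  -- This term makes both conclusions strict when the squares and products are expanded around `q`.
  have hpos : 0 < ∑ i, (p i - q i) ^ 2 := by
    obtain ⟨i, hi⟩ := Function.ne_iff.1 hqp
    exact Finset.sum_pos' (fun i _ => sq_nonneg _)
      ⟨i, Finset.mem_univ i, sq_pos_of_ne_zero (sub_ne_zero.2 (Ne.symm hi))⟩
  have hle : ∀ C ∈ s, ∑ i, (p i - q i) * (u C i - q i) ≤ 0 := by
    intro C hC
    have h := hmin _ (huK ⟨C, hC⟩)
    simp only [PiLp.inner_apply, PiLp.sub_apply, hqw, RCLike.inner_apply, conj_trivial] at h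
    simpa only [mul_comm] using h
  constructor
  · intro C hC
    have h : ∑ i, (p i - q i) * (u C i - p i) =
        ∑ i, (p i - q i) * (u C i - q i) - ∑ i, (p i - q i) ^ 2 := by
      rw [← Finset.sum_sub_distrib]
      exact Finset.sum_congr rfl fun i _ => by ring
    linarith [hle C hC]
  · intro C hC
    have h : ∑ i, (u C i - p i) ^ 2 = ∑ i, (u C i - q i) ^ 2 -
        2 * ∑ i, (p i - q i) * (u C i - q i) + ∑ i, (p i - q i) ^ 2 := by
      rw [Finset.mul_sum, ← Finset.sum_sub_distrib, ← Finset.sum_add_distrib]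
      exact Finset.sum_congr rfl fun i _ => by ring
    linarith [hle C hC]

end Separation

/-! ### Betting and penalty criteria -/

section Criteria

variable {Ω : Type*} {ℰ : Set (Set Ω)}

/-- Averaging an expression affine in the indicators replaces each indicator by its price. Gains and
differences of penalties are of this kind. -/
theorem sum_mul_eq_of_weights (F : Finset ℰ) {x : Set Ω → ℝ} (hx1 : ∑ C ∈ finAtoms F, x C = 1)
    {p : F → ℝ} (hx : ∀ E : F, ∑ C ∈ finAtoms F, minInd (E : Set Ω) C * x C = p E)
    (a b : F → ℝ) :
    ∑ C ∈ finAtoms F, x C * ∑ E : F, (a E * minInd (E : Set Ω) C + b E) =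
      ∑ E : F, (a E * p E + b E) := by
  simp_rw [Finset.mul_sum]
  rw [Finset.sum_comm]
  refine Finset.sum_congr rfl fun E _ => ?_
  calc ∑ C ∈ finAtoms F, x C * (a E * minInd (E : Set Ω) C + b E)
      = a E * ∑ C ∈ finAtoms F, minInd (E : Set Ω) C * x C + b E * ∑ C ∈ finAtoms F, x C := by
        rw [Finset.mul_sum, Finset.mul_sum, ← Finset.sum_add_distrib]
        exact Finset.sum_congr rfl fun C _ => by ring
    _ = a E * p E + b E := by rw [hx, hx1, mul_one]

/-- A function with a non-negative weighted average is non-negative somewhere. -/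
theorem exists_nonneg_of_weights {κ : Type*} {s : Finset κ} {x : κ → ℝ} (hx0 : ∀ C ∈ s, 0 ≤ x C)
    (hx1 : ∑ C ∈ s, x C = 1) {f : κ → ℝ} (hf : 0 ≤ ∑ C ∈ s, x C * f C) : ∃ C ∈ s, 0 ≤ f C := by
  by_contra! hneg
  have hzero : ∀ C ∈ s, x C * f C = 0 := by
    have hle : ∀ C ∈ s, x C * f C ≤ 0 := fun C hC =>
      mul_nonpos_of_nonneg_of_nonpos (hx0 C hC) (hneg C hC).le
    exact (Finset.sum_eq_zero_iff_of_nonpos hle).1 (le_antisymm (Finset.sum_nonpos hle) hf)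
  have hx : ∑ C ∈ s, x C = 0 := Finset.sum_eq_zero fun C hC =>
    (mul_eq_zero.1 (hzero C hC)).resolve_right (hneg C hC).ne
  rw [hx] at hx1
  exact zero_ne_one hx1

theorem Coherent3P.coherent4P [Nonempty Ω] {P : ℰ → unitInterval} (h : Coherent3P P) :
    Coherent4P P := by
  intro F hF stake
  obtain ⟨x, hx, hx1, hx0⟩ := h F hF
  have hsum : ∑ C ∈ finAtoms F, x C * gain P F stake C = 0 := by
    have := sum_mul_eq_of_weights F hx1 (p := fun E : F => (P E : ℝ)) (fun E => hx E E.2)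
      stake (fun E => -(stake E * P E))
    simp only [add_neg_cancel, Finset.sum_const_zero] at this
    rw [← this]
    refine Finset.sum_congr rfl fun C _ => ?_
    rw [gain]
    congr 1
    exact Finset.sum_congr rfl fun E _ => by ring
  obtain ⟨C, hC, hgain⟩ := exists_nonneg_of_weights hx0 hx1 hsum.ge
  obtain ⟨D, hD, hmax⟩ := (finAtoms F).exists_max_image (gain P F stake) (finAtoms_nonempty F)
  refine ⟨gain P F stake D, ⟨⟨D, hD, rfl⟩, ?_⟩, hgain.trans (hmax C hC)⟩
  rintro _ ⟨B, hB, rfl⟩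
  exact hmax B hB

theorem Coherent3P.coherent5P {P : ℰ → unitInterval} (h : Coherent3P P) : Coherent5P P := by
  rintro F hF ⟨Q, -, hQ⟩
  obtain ⟨x, hx, hx1, hx0⟩ := h F hF
  have hsum : ∑ C ∈ finAtoms F, x C * (penalty F Q C - penalty F (fun E : F => P E) C) =
      ∑ E : F, ((P E : ℝ) - Q E) ^ 2 := by
    -- The squares of the indicator `u` cancel: `(u - Q)² - (u - P)² = 2(P - Q)u + Q² - P²`, which
    -- equals `(P - Q)²` at `u = P`.
    have := sum_mul_eq_of_weights F hx1 (p := fun E : F => (P E : ℝ)) (fun E => hx E E.2)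
      (fun E => 2 * ((P E : ℝ) - Q E)) (fun E => (Q E : ℝ) ^ 2 - (P E : ℝ) ^ 2)
    calc _ = _ := Finset.sum_congr rfl fun C _ => by
          rw [penalty, penalty, ← Finset.sum_sub_distrib]
          congr 1
          exact Finset.sum_congr rfl fun E _ => by ring
      _ = _ := this
      _ = _ := Finset.sum_congr rfl fun E _ => by ring
  obtain ⟨C, hC, hle⟩ := exists_nonneg_of_weights hx0 hx1
    (hsum ▸ Finset.sum_nonneg fun E _ => sq_nonneg _)
  linarith [hQ C hC]

/-- An incoherent assessment of `F` is beaten by an assessment which is a mixture of atoms. -/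
theorem exists_weights_or_dominated [Nonempty Ω] (P : ℰ → unitInterval) (F : Finset ℰ) :
    (∃ x : Set Ω → ℝ, (∀ E ∈ F, ∑ C ∈ finAtoms F, minInd (E : Set Ω) C * x C = P E) ∧
      ∑ C ∈ finAtoms F, x C = 1 ∧ ∀ C ∈ finAtoms F, 0 ≤ x C) ∨
    ∃ Q : F → unitInterval, Q ≠ (fun E : F => P E) ∧
      (∀ C ∈ finAtoms F, gain P F (fun E => (P E : ℝ) - Q E) C < 0) ∧
      ∀ C ∈ finAtoms F, penalty F Q C < penalty F (fun E : F => P E) C := by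
  obtain ⟨x, hx0, hx1, hx⟩ := exists_weights_or_separation (finAtoms F) (finAtoms_nonempty F)
    (fun C (E : F) => minInd (E : Set Ω) C) (fun E => (P E : ℝ))
  -- The projection is a mixture of values in `[0, 1]`, so it is itself an admissible assessment.
  have hmem : ∀ E : F, ∑ C ∈ finAtoms F, minInd (E : Set Ω) C * x C ∈ unitInterval := by
    intro E
    have h01 : ∀ C ∈ finAtoms F, minInd (E : Set Ω) C ∈ Set.Icc (0 : ℝ) 1 := fun C hC =>
      minInd_mem_Icc _ (nonempty_of_mem_finAtoms hC)
    refine ⟨Finset.sum_nonneg fun C hC => mul_nonneg (h01 C hC).1 (hx0 C hC), ?_⟩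
    rw [← hx1]
    exact Finset.sum_le_sum fun C hC => mul_le_of_le_one_left (hx0 C hC) (h01 C hC).2
  rcases hx _ (fun _ => rfl) with heq | ⟨hne, hgain, hpen⟩
  · exact Or.inl ⟨x, fun E hE => congrFun heq ⟨E, hE⟩, hx1, hx0⟩
  · refine Or.inr ⟨fun E => ⟨_, hmem E⟩, fun heq => hne ?_, hgain, hpen⟩
    funext E
    exact congrArg Subtype.val (congrFun heq E)

theorem Coherent4P.coherent3P [Nonempty Ω] {P : ℰ → unitInterval} (h : Coherent4P P) :
    Coherent3P P := by
  intro F hF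
  refine (exists_weights_or_dominated P F).resolve_right ?_
  rintro ⟨Q, -, hgain, -⟩
  obtain ⟨M, ⟨⟨C, hC, rfl⟩, -⟩, hM⟩ := h F hF fun E => (P E : ℝ) - Q E
  exact (hgain C hC).not_ge hM

theorem Coherent5P.coherent3P [Nonempty Ω] {P : ℰ → unitInterval} (h : Coherent5P P) :
    Coherent3P P := by
  intro F hF
  refine (exists_weights_or_dominated P F).resolve_right ?_
  rintro ⟨Q, hne, -, hpen⟩
  exact h F hF ⟨Q, hne, hpen⟩

end Criteria

end Coherence

theorem corollary1 {Ω : Type*} [Nonempty Ω] (ℰ : Set (Set Ω)) (P : ℰ → unitInterval) :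
    List.TFAE [Coherence.Coherent1P P, Coherence.Coherent2P P, Coherence.Coherent3P P,
      Coherence.Coherent4P P, Coherence.Coherent5P P] := by
  tfae_have 1 ↔ 2 := Coherence.coherent1P_iff_coherent2P P
  tfae_have 1 → 3 := Coherence.Coherent1P.coherent3P
  tfae_have 3 → 1 := Coherence.Coherent3P.coherent1P
  tfae_have 3 → 4 := Coherence.Coherent3P.coherent4P
  tfae_have 4 → 3 := Coherence.Coherent4P.coherent3P
  tfae_have 3 → 5 := Coherence.Coherent3P.coherent5P
  tfae_have 5 → 3 := Coherence.Coherent5P.coherent3P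
  tfae_finish
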